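/- Let $n>p\ge 0$, let $K\subset\mathbb R^n$ be compact (possibly empty), and let $\rho:\mathbb R^n\setminus K\to\mathbb R_{\ge 0}$ be an analytic submersion that is proper in the sense that $\rho(x)\to\infty$ as $\|x\|\to\infty$. Let $X\subset\mathbb R^n$ be a closed subset that is a (embedded) $C^2$ submanifold, and let $f:X\to\mathbb R^p$ be a $C^2$ map. Let $\mathbb X$ be the closure of $\operatorname{graph} f$ in $\mathbb P^n\times\mathbb R^p$, where $\mathbb R^n\subset\mathbb P^n$ via $x\mapsto[1:x]$; let $\mathbb X^\infty$ be the part of $\mathbb X$ over the hyperplane at infinity $\{x_0=0\}$ of $\mathbb P^n$, and let $\tau:\mathbb P^n\times\mathbb R^p\to\mathbb R^p$ be the projection. Say that $f$ is $\rho$-regular at $p_0\in\mathbb X^\infty$ if there are open neighbourhoods $U\subset\mathbb P^n\times\mathbb R^p$ of $p_0$ and $D\subset\mathbb R^p$ of $\tau(p_0)$ such that for every $t\in D$ and every $x\in X\setminus K$ with $f(x)=t$ and $(x,f(x))\in U$, the fibre $f^{-1}(t)$ is nonsingular at $x$ (i.e. $f$ is a submersion at $x$) and transversal at $x$ to the level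 of $\rho$ through $x$. The fibre $f^{-1}(t_0)$ is $\rho$-regular at infinity if $f$ is $\rho$-regular at every point of $\mathbb X^\infty\cap\tau^{-1}(t_0)$. Let $\mathcal M(f)$ be the set of points of $X\setminus K$ at which $(f,\rho):X\setminus K\to\mathbb R^p\times\mathbb R$ is not a submersion, and let $S(f)$ be the set of all $t_0\in\mathbb R^p$ for which there is a sequence $x_j\in\mathcal M(f)$ with $\|x_j\|\to\infty$ and $f(x_j)\to t_0$. Say that $f$ is topologically trivial at infinity at $t_0\in\mathbb R^p$ if there are a compact set $C\subset\mathbb R^n$ and a ball $B_\delta\subset\mathbb R^p$ of radius $\delta>0$ centred at $t_0$ such that the restriction $f_|:(X\setminus C)\cap f^{-1}(B_\delta)\to B_\delta$ is a trivial topological fibration (possibly with empty fibre), i.e. there are a topological space $F$ and a homeomorphism $(X\setminus C)\cap f^{-1}(B_\delta)\cong B_\delta\times F$ over $B_\delta$. Then, for every $t_0\in\mathbb R^p$: if the fibre $f^{-1}(t_0)$ is $\rho$-regular at infinity, then $f$ is topologically trivial at infinity at $t_0$. In particular, $f$ is topologically trivial at infinity at every $t_0\in\mathbb R^p\setminus S(f)$.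 -/

import Mathlib

open Set Filter Topology

namespace RhoReg

/-- Euclidean space `ℝⁿ`. -/
abbrev E (n : ℕ) : Type := EuclideanSpace ℝ (Fin n)

/-! ### Submanifolds of `ℝⁿ` -/

/-- `X` is a (locally closed, embedded) `d`-dimensional submanifold of class `C²` of `ℝⁿ`: around
each of its points there is a `C²` diffeomorphism between open subsets of `ℝⁿ` that carries `X`
to the coordinate slice where the coordinates with index `≥ d` vanish. -/
def IsC2Submanifold {n : ℕ} (d : ℕ) (X : Set (E n)) : Prop :=
  d ≤ n ∧ ∀ x ∈ X, ∃ φ : OpenPartialHomeomorph (E n) (E n), x ∈ φ.source ∧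
    ContDiffOn ℝ 2 φ φ.source ∧ ContDiffOn ℝ 2 φ.symm φ.target ∧
    ∀ y ∈ φ.source, (y ∈ X ↔ ∀ i : Fin n, d ≤ (i : ℕ) → φ y i = 0)

/-- The tangent space of `X` at `x`, spanned by the tangent directions of `X` at `x`. (For a
submanifold these directions already form a linear subspace.) -/
def tangentSpace {n : ℕ} (X : Set (E n)) (x : E n) : Submodule ℝ (E n) :=
  Submodule.span ℝ (tangentConeAt ℝ X x)

/-! ### The function `ρ` -/

/-- `ρ : ℝⁿ \ K → [0, ∞)` is an analytic submersion, proper in the sense that `ρ x → ∞` when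
`‖x‖ → ∞`, where `K` is compact. The values of `ρ` on `K` are irrelevant. -/
structure IsProperSubmersionOff {n : ℕ} (K : Set (E n)) (ρ : E n → ℝ) : Prop where
  isCompact : IsCompact K
  nonneg : ∀ x ∉ K, 0 ≤ ρ x
  analytic : AnalyticOnNhd ℝ ρ Kᶜ
  submersion : ∀ x ∉ K, Function.Surjective (fderiv ℝ ρ x)
  proper : Tendsto ρ (cocompact (E n)) atTop

section Maps

variable {n p : ℕ} (K : Set (E n)) (ρ : E n → ℝ) (X : Set (E n)) (f : E n → E p)

/-! ### Transversality and the Milnor set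

A map on `X` is represented by a function on `ℝⁿ` of which only the values on `X` matter.
For `f` of class `C¹` on the submanifold `X`, the restriction of `fderivWithin ℝ f X x` to the
tangent space of `X` at `x` is the differential of `f : X → ℝᵖ` at `x`. -/

/-- The tangent space at `x` of the fibre of `f : X → ℝᵖ` through `x`: the kernel of the
differential of `f` on the tangent space of `X`. -/
noncomputable def fibreTangentSpace (x : E n) : Submodule ℝ (E n) :=
  tangentSpace X x ⊓ LinearMap.ker (fderivWithin ℝ f X x : E n →ₗ[ℝ] E p)

/-- The tangent space at `x` of the level hypersurface of `ρ` through `x`. -/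
noncomputable def levelTangentSpace (x : E n) : Submodule ℝ (E n) :=
  LinearMap.ker (fderiv ℝ ρ x : E n →ₗ[ℝ] ℝ)

/-- The fibre of `f : X → ℝᵖ` through `x` is, at `x`, nonsingular (`f` is a submersion at `x`)
and transversal in `ℝⁿ` to the level of `ρ` through `x`. -/
def TransversalAt (x : E n) : Prop :=
  (∀ w : E p, ∃ v ∈ tangentSpace X x, fderivWithin ℝ f X x v = w) ∧
    fibreTangentSpace X f x ⊔ levelTangentSpace ρ x = ⊤

/-- The Milnor set: the set of points of `X \ K` where `(f, ρ) : X \ K → ℝᵖ × ℝ` is not a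
submersion. -/
def milnorSet : Set (E n) :=
  {x | x ∈ X ∧ x ∉ K ∧ ¬ ∀ w : E p × ℝ, ∃ v ∈ tangentSpace X x,
    (fderivWithin ℝ f X x v, fderiv ℝ ρ x v) = w}

/-- The set `S(f)` of asymptotic `ρ`-nonregular values. -/
def asymptoticNonregularValues : Set (E p) :=
  {t₀ | ∃ x : ℕ → E n, (∀ j, x j ∈ milnorSet K ρ X f) ∧
    Tendsto (fun j => ‖x j‖) atTop atTop ∧ Tendsto (fun j => f (x j)) atTop (𝓝 t₀)}

end Maps

/-! ### Projective compactification of the source -/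

/-- Real projective space `ℙⁿ`, with homogeneous coordinates `[x₀ : x]`, `x₀ ∈ ℝ`, `x ∈ ℝⁿ`. -/
def ProjSpace (n : ℕ) : Type := Projectivization ℝ (ℝ × E n)

/-- The quotient topology on `ℙⁿ`. -/
noncomputable instance (n : ℕ) : TopologicalSpace (ProjSpace n) :=
  TopologicalSpace.coinduced
    (fun v : {v : ℝ × E n // v ≠ 0} => Projectivization.mk ℝ v.1 v.2) inferInstance

/-- The affine chart `ℝⁿ → ℙⁿ`, `x ↦ [1 : x]`. -/
noncomputable def affineChart {n : ℕ} (x : E n) : ProjSpace n :=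
  Projectivization.mk ℝ ((1, x) : ℝ × E n) (by simp)

/-- The hyperplane at infinity `x₀ = 0` of `ℙⁿ`. -/
def hyperplaneAtInfinity (n : ℕ) : Set (ProjSpace n) :=
  {q | ∃ (v : E n) (hv : ((0, v) : ℝ × E n) ≠ 0), q = Projectivization.mk ℝ ((0, v) : ℝ × E n) hv}

section Maps

variable {n p : ℕ} (K : Set (E n)) (ρ : E n → ℝ) (X : Set (E n)) (f : E n → E p)

/-- The closure in `ℙⁿ × ℝᵖ` of the graph of `f : X → ℝᵖ`. -/
def graphClosure : Set (ProjSpace n × E p) :=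
  closure ((fun x => (affineChart x, f x)) '' X)

/-- The part at infinity of the closure of the graph of `f : X → ℝᵖ`. -/
def graphAtInfinity : Set (ProjSpace n × E p) :=
  graphClosure X f ∩ {q | q.1 ∈ hyperplaneAtInfinity n}

/-- `f : X → ℝᵖ` is `ρ`-regular at the point `q` of `ℙⁿ × ℝᵖ`: for some open neighbourhoods `U`
of `q` and `D` of the projection of `q` to `ℝᵖ`, all the fibres over `D` are, inside `U`,
transversal to the levels of `ρ`. The graph of `f` is identified with `X`. -/
def RhoRegularAt (q : ProjSpace n × E p) : Prop :=
  ∃ U : Set (ProjSpace n × E p), IsOpen U ∧ q ∈ U ∧ ∃ D : Set (E p), IsOpen D ∧ q.2 ∈ D ∧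
    ∀ t ∈ D, ∀ x ∈ X, x ∉ K → f x = t → (affineChart x, f x) ∈ U → TransversalAt ρ X f x

/-- The fibre of `f : X → ℝᵖ` over `t₀` is `ρ`-regular at infinity. -/
def FibreRhoRegularAtInfinity (t₀ : E p) : Prop :=
  ∀ q ∈ graphAtInfinity X f, q.2 = t₀ → RhoRegularAt K ρ X f q

/-- `f : X → ℝᵖ` is topologically trivial at infinity at the value `t₀`: for some compact
`C ⊆ ℝⁿ` and some ball `B` centred at `t₀`, the restriction `(X \ C) ∩ f⁻¹(B) → B` of `f` is a
trivial topological fibration, i.e. it is isomorphic over `B` to a projection `B × F → B`.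
The fibre `F` may be empty. -/
def TopTrivialAtInfinity (t₀ : E p) : Prop :=
  ∃ C : Set (E n), IsCompact C ∧ ∃ δ : ℝ, 0 < δ ∧ ∃ (F : Type) (_ : TopologicalSpace F),
    IsHomeomorphicTrivialFiberBundle F
      (MapsTo.restrict f ((X \ C) ∩ f ⁻¹' Metric.ball t₀ δ) (Metric.ball t₀ δ)
        (fun _ hx => hx.2))

end Maps

end RhoReg

/-! Both claims reduce to the second. If `t₀` were in `S(f)`, a sequence of Milnor points going to
infinity would have, along a subsequence, directions converging to a unit vector `v`. Then `([0 :
v], t₀)` lies in the part at infinity of the graph closure, and `ρ`-regularity there contradicts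
membership in the Milnor set (`FibreRhoRegularAtInfinity.notMem`).

If `t₀` is not in `S(f)`, then `(f, ρ)` is a submersion on the part of `X` far out and over a small
ball around `t₀`. Constant fields on the ball therefore lift to fields tangent to `X` and to the
levels of `ρ`: locally by inverting differentials, globally by a partition of unity
(`exists_contDiff_lift`).

Flowing along a lift moves `f` along a segment and preserves `ρ`. Properness of `ρ` then prevents
escape to infinity, and keeping only `ρ > R`, where `R` bounds `ρ` on the inner sphere, prevents
escape through that sphere (`IsLift.exists_transport`). Transport to the fibre over `t₀` is the
trivialisation; its continuity and uniqueness come from Gronwall (`IsLift.dist_transport_lt`). -/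

namespace RhoReg

/-! ### Slice charts and calculus on the submanifold -/

/-- `φ` is a chart of class `C²` around points of `φ.source` that straightens `X` to the range of
the linear projection `P`. -/
structure IsSliceChart {n : ℕ} (X : Set (E n)) (φ : OpenPartialHomeomorph (E n) (E n))
    (P : E n →L[ℝ] E n) : Prop where
  contDiffOn : ContDiffOn ℝ 2 φ φ.source
  contDiffOn_symm : ContDiffOn ℝ 2 φ.symm φ.target
  proj_proj : ∀ z, P (P z) = P z
  mem_iff : ∀ y ∈ φ.source, (y ∈ X ↔ P (φ y) = φ y)

theorem IsC2Submanifold.exists_isSliceChart {n d : ℕ} {X : Set (E n)} (hX : IsC2Submanifold d X)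
    {x : E n} (hx : x ∈ X) :
    ∃ (φ : OpenPartialHomeomorph (E n) (E n)) (P : E n →L[ℝ] E n),
      x ∈ φ.source ∧ IsSliceChart X φ P := by
  obtain ⟨φ, hxφ, h1, h2, h3⟩ := hX.2 x hx
  let S : Submodule ℝ (E n) :=
    { carrier := {z | ∀ i : Fin n, d ≤ (i : ℕ) → z i = 0}
      add_mem' := fun {a b} ha hb i hi => by simp [ha i hi, hb i hi]
      zero_mem' := fun i _ => by simp
      smul_mem' := fun c a ha i hi => by simp [ha i hi] }
  refine ⟨φ, S.starProjection, hxφ, h1, h2, fun z => ?_, fun y hy => ?_⟩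
  · exact Submodule.starProjection_eq_self_iff.2 (Submodule.starProjection_apply_mem S z)
  · rw [Submodule.starProjection_eq_self_iff]
    exact h3 y hy

namespace IsSliceChart

variable {n : ℕ} {X : Set (E n)} {φ : OpenPartialHomeomorph (E n) (E n)} {P : E n →L[ℝ] E n}

theorem differentiableAt (h : IsSliceChart X φ P) {y : E n} (hy : y ∈ φ.source) :
    DifferentiableAt ℝ φ y :=
  (h.contDiffOn.contDiffAt (φ.open_source.mem_nhds hy)).differentiableAt (by norm_num)

theorem differentiableAt_symm (h : IsSliceChart X φ P) {z : E n} (hz : z ∈ φ.target) :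
    DifferentiableAt ℝ φ.symm z :=
  (h.contDiffOn_symm.contDiffAt (φ.open_target.mem_nhds hz)).differentiableAt (by norm_num)

theorem symm_proj_mem (h : IsSliceChart X φ P) {z : E n} (hz : P z ∈ φ.target) :
    φ.symm (P z) ∈ X := by
  rw [h.mem_iff _ (φ.map_target hz), φ.right_inv hz, h.proj_proj]

/-- `P ∘ φ` and `φ` agree on `X` near `y`, and derivatives within `X` of the same function agree on
the tangent cone, hence on its span. -/
theorem proj_fderiv (h : IsSliceChart X φ P) {y : E n} (hy : y ∈ φ.source) (hyX : y ∈ X)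
    {v : E n} (hv : v ∈ tangentSpace X y) : P (fderiv ℝ φ y v) = fderiv ℝ φ y v := by
  have h1 : HasFDerivWithinAt (fun y => P (φ y)) (P ∘L fderiv ℝ φ y) X y :=
    (P.hasFDerivAt.comp y (h.differentiableAt hy).hasFDerivAt).hasFDerivWithinAt
  have h2 : HasFDerivWithinAt (fun y => P (φ y)) (fderiv ℝ φ y) X y := by
    refine (h.differentiableAt hy).hasFDerivAt.hasFDerivWithinAt.congr_of_eventuallyEq ?_
      ((h.mem_iff y hy).1 hyX)
    filter_upwards [self_mem_nhdsWithin,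
      mem_nhdsWithin_of_mem_nhds (φ.open_source.mem_nhds hy)] with z hz hzs
    exact (h.mem_iff z hzs).1 hz
  have h3 := h1.unique_on h2
  have h4 : tangentSpace X y ≤ LinearMap.eqLocus (P ∘L fderiv ℝ φ y : E n →ₗ[ℝ] E n)
      (fderiv ℝ φ y : E n →ₗ[ℝ] E n) := Submodule.span_le.2 h3
  exact h4 hv

/-- `φ.symm` maps the fixed space of `P`, near `φ y`, into `X`, and a derivative carries tangent
cones to tangent cones. -/
theorem fderiv_symm_mem (h : IsSliceChart X φ P) {y : E n} (hy : y ∈ φ.source) (hyX : y ∈ X)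
    {u : E n} (hu : P u = u) : fderiv ℝ φ.symm (φ y) u ∈ tangentSpace X y := by
  have hz : φ y ∈ φ.target := φ.map_source hy
  have hPz : P (φ y) = φ y := (h.mem_iff y hy).1 hyX
  have h1 : u ∈ tangentConeAt ℝ {z | P z = z} (φ y) := by
    have := mem_tangentConeAt_of_segment_subset (s := {z | P z = z}) (x := φ y) (y := φ y + u) ?_
    · simpa using this
    · rw [segment_eq_image']
      rintro _ ⟨t, -, rfl⟩
      simp [hPz, hu]
  rw [← tangentConeAt_inter_nhds (φ.open_target.mem_nhds hz)] at h1
  have h2 := (h.differentiableAt_symm hz).hasFDerivAt.hasFDerivWithinAt.mapsTo_tangent_cone h1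
  rw [φ.left_inv hy] at h2
  refine Submodule.subset_span (tangentConeAt_mono ?_ h2)
  rintro _ ⟨z, ⟨hzP, hzt⟩, rfl⟩
  have : P z = z := hzP
  rw [← this]
  exact h.symm_proj_mem (by rwa [this])

theorem fderiv_symm_fderiv (h : IsSliceChart X φ P) {y : E n} (hy : y ∈ φ.source) (v : E n) :
    fderiv ℝ φ.symm (φ y) (fderiv ℝ φ y v) = v := by
  have hz : φ y ∈ φ.target := φ.map_source hy
  have h1 := (h.differentiableAt_symm hz).hasFDerivAt.comp y (h.differentiableAt hy).hasFDerivAt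
  have h2 : HasFDerivAt (φ.symm ∘ φ) (ContinuousLinearMap.id ℝ (E n)) y :=
    (hasFDerivAt_id y).congr_of_eventuallyEq (by
      filter_upwards [φ.open_source.mem_nhds hy] with z hzs using φ.left_inv hzs)
  exact congrArg (fun L => L v) (h1.unique h2)

variable {W : Type*} [NormedAddCommGroup W] [NormedSpace ℝ W]

/-- Composing with `φ.symm ∘ P` extends a function known only on `X` to an open set of `ℝⁿ`, where
ordinary derivatives are available. -/
theorem hasFDerivAt_comp_symm_proj (h : IsSliceChart X φ P) {y : E n} (hy : y ∈ φ.source)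
    (hyX : y ∈ X) {g : E n → W} {g' : E n →L[ℝ] W} (hg : HasFDerivWithinAt g g' X y) :
    HasFDerivAt (fun z => g (φ.symm (P z))) (g' ∘L fderiv ℝ φ.symm (φ y) ∘L P) (φ y) := by
  have hz : φ y ∈ φ.target := φ.map_source hy
  have hPz : P (φ y) = φ y := (h.mem_iff y hy).1 hyX
  have h1 : HasFDerivAt (fun z => φ.symm (P z)) (fderiv ℝ φ.symm (φ y) ∘L P) (φ y) := by
    refine HasFDerivAt.comp (g := φ.symm) (φ y) ?_ P.hasFDerivAt
    rw [hPz]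
    exact (h.differentiableAt_symm hz).hasFDerivAt
  have hO : P ⁻¹' φ.target ∈ 𝓝 (φ y) :=
    P.continuous.continuousAt.preimage_mem_nhds (by rw [hPz]; exact φ.open_target.mem_nhds hz)
  refine HasFDerivWithinAt.hasFDerivAt (s := P ⁻¹' φ.target) ?_ hO
  refine HasFDerivWithinAt.comp (t := X) (g := g) (φ y) ?_ h1.hasFDerivWithinAt
    (fun z hz => h.symm_proj_mem hz)
  rwa [hPz, φ.left_inv hy]

theorem contDiffAt_comp_symm_proj (h : IsSliceChart X φ P) {y : E n} (hy : y ∈ φ.source)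
    (hyX : y ∈ X) {g : E n → W} (hg : ContDiffWithinAt ℝ 2 g X y) :
    ContDiffAt ℝ 2 (fun z => g (φ.symm (P z))) (φ y) := by
  have hz : φ y ∈ φ.target := φ.map_source hy
  have hPz : P (φ y) = φ y := (h.mem_iff y hy).1 hyX
  have h1 : ContDiffAt ℝ 2 (fun z => φ.symm (P z)) (φ y) := by
    refine ContDiffAt.comp (g := φ.symm) (φ y) ?_ P.contDiff.contDiffAt
    rw [hPz]
    exact h.contDiffOn_symm.contDiffAt (φ.open_target.mem_nhds hz)
  have hO : P ⁻¹' φ.target ∈ 𝓝 (φ y) :=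
    P.continuous.continuousAt.preimage_mem_nhds (by rw [hPz]; exact φ.open_target.mem_nhds hz)
  refine ContDiffWithinAt.contDiffAt (s := P ⁻¹' φ.target) ?_ hO
  refine ContDiffWithinAt.comp (t := X) (g := g) (φ y) ?_ h1.contDiffWithinAt
    (fun z hz => h.symm_proj_mem hz)
  rwa [hPz, φ.left_inv hy]

/-- A submersion on a submanifold admits, locally, a `C¹` family of right inverses of its
differentials. -/
theorem exists_local_lift [FiniteDimensional ℝ W] (h : IsSliceChart X φ P) {x : E n}
    (hx : x ∈ φ.source) (hxX : x ∈ X) {g : E n → W} {g' : E n → E n →L[ℝ] W}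
    (hg : ContDiffWithinAt ℝ 2 g X x) (hg' : ∀ᶠ y in 𝓝[X] x, HasFDerivWithinAt g (g' y) X y)
    (hsurj : ∀ w, ∃ v ∈ tangentSpace X x, g' x v = w) :
    ∃ A : E n → W →L[ℝ] E n, ContDiffAt ℝ 1 A x ∧ ∀ᶠ y in 𝓝[X] x, ∀ w,
      A y w ∈ tangentSpace X y ∧ g' y (A y w) = w := by
  set G : E n → W := fun z => g (φ.symm (P z)) with hG
  have hGC : ContDiffAt ℝ 2 G (φ x) := h.contDiffAt_comp_symm_proj hx hxX hg
  have hGd : ∀ y ∈ φ.source, y ∈ X → HasFDerivWithinAt g (g' y) X y →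
      fderiv ℝ G (φ y) = g' y ∘L fderiv ℝ φ.symm (φ y) ∘L P := fun y hy hyX hyg =>
    (h.hasFDerivAt_comp_symm_proj hy hyX hyg).fderiv
  have hgx : HasFDerivWithinAt g (g' x) X x := hg'.self_of_nhdsWithin hxX
  have hGs : Function.Surjective (fderiv ℝ G (φ x)) := by
    intro w
    obtain ⟨v, hv, rfl⟩ := hsurj w
    refine ⟨fderiv ℝ φ x v, ?_⟩
    rw [hGd x hx hxX hgx]
    simp [h.proj_fderiv hx hxX hv, h.fderiv_symm_fderiv hx]
  obtain ⟨B, hB⟩ := (fderiv ℝ G (φ x)).exists_rightInverse_of_surjective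
    (LinearMap.range_eq_top.2 hGs)
  -- `B` inverts the differential of `G` on the right only at `φ x`. Nearby, `Q` is still invertible
  -- and `B ∘ Q⁻¹` is a right inverse, of class `C¹` because `G` is `C²`.
  set Q : E n → W →L[ℝ] W := fun z => fderiv ℝ G z ∘L B with hQ
  have hG1 : ContDiffAt ℝ 1 (fderiv ℝ G) (φ x) := hGC.fderiv_right (by norm_num)
  have hQC : ContDiffAt ℝ 1 Q (φ x) := hG1.clm_comp contDiffAt_const
  have hQx : Q (φ x) = 1 := hB
  have hinv : ContDiffAt ℝ 1 (fun z => Ring.inverse (Q z)) (φ x) := by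
    refine ContDiffAt.comp (g := Ring.inverse) (φ x) ?_ hQC
    rw [hQx]
    exact contDiffAt_ringInverse ℝ (1 : (W →L[ℝ] W)ˣ)
  have hφC : ContDiffAt ℝ 1 φ x :=
    (h.contDiffOn.contDiffAt (φ.open_source.mem_nhds hx)).of_le (by norm_num)
  have hψC : ContDiffAt ℝ 1 (fderiv ℝ φ.symm) (φ x) :=
    (h.contDiffOn_symm.contDiffAt (φ.open_target.mem_nhds (φ.map_source hx))).fderiv_right
      (by norm_num)
  refine ⟨fun y => fderiv ℝ φ.symm (φ y) ∘L P ∘L B ∘L Ring.inverse (Q (φ y)), ?_, ?_⟩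
  · have : ContDiffAt ℝ 1 (fun z => fderiv ℝ φ.symm z ∘L P ∘L B ∘L Ring.inverse (Q z)) (φ x) :=
      hψC.clm_comp (contDiffAt_const.clm_comp (contDiffAt_const.clm_comp hinv))
    exact this.comp x hφC
  · have hU : ∀ᶠ y in 𝓝 x, IsUnit (Q (φ y)) := by
      have : ContinuousAt (fun y => Q (φ y)) x := hQC.continuousAt.comp hφC.continuousAt
      exact this.eventually (by simp only [hQx]; exact Units.isOpen.mem_nhds isUnit_one)
    filter_upwards [mem_nhdsWithin_of_mem_nhds hU, hg', self_mem_nhdsWithin,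
      mem_nhdsWithin_of_mem_nhds (φ.open_source.mem_nhds hx)] with y hyU hyg hyX hys w
    refine ⟨h.fderiv_symm_mem hys hyX (h.proj_proj _), ?_⟩
    have h1 := Ring.mul_inverse_cancel _ hyU
    have h2 := congrArg (fun L => L w) h1
    simpa [hQ, hGd y hys hyX hyg, h.proj_proj] using h2

/-- A curve that starts on a submanifold and follows a `C¹` vector field that is tangent to the
submanifold stays on the submanifold for a short time. -/
theorem eventually_mem_of_tangent (h : IsSliceChart X φ P) {x : E n} (hx : x ∈ φ.source)
    (hxX : x ∈ X) {V : E n → E n} (hV : ContDiffAt ℝ 1 V x)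
    (hT : ∀ᶠ y in 𝓝[X] x, V y ∈ tangentSpace X y) {γ : ℝ → E n} {a b : ℝ} (hab : a < b)
    (hγ : ContinuousOn γ (Icc a b)) (hγa : γ a = x)
    (hγ' : ∀ᶠ s in 𝓝[≥] a, HasDerivWithinAt γ (V (γ s)) (Ici s) s) :
    ∀ᶠ s in 𝓝[≥] a, γ s ∈ X := by
  have hPx : P (φ x) = φ x := (h.mem_iff x hx).1 hxX
  have hzt : φ x ∈ φ.target := φ.map_source hx
  set D : E n → E n := fun z => fderiv ℝ φ (φ.symm z) (V (φ.symm z)) with hD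
  -- `H` is the component of the field, read in the chart, transverse to the slice. It vanishes on
  -- the slice and is Lipschitz, so `e = φ ∘ γ - P ∘ φ ∘ γ` satisfies `‖e'‖ ≤ K ‖e‖` with `e a = 0`,
  -- which forces `e = 0`.
  set H : E n → E n := fun z => D z - P (D z) with hH
  have hψC : ContDiffAt ℝ 1 φ.symm (φ x) :=
    (h.contDiffOn_symm.contDiffAt (φ.open_target.mem_nhds hzt)).of_le (by norm_num)
  have hDC : ContDiffAt ℝ 1 D (φ x) := by
    have h1 : ContDiffAt ℝ 1 (fun y => fderiv ℝ φ y (V y)) x :=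
      ((h.contDiffOn.contDiffAt (φ.open_source.mem_nhds hx)).fderiv_right
        (by norm_num)).clm_apply hV
    refine ContDiffAt.comp (g := fun y => fderiv ℝ φ y (V y)) (φ x) ?_ hψC
    rwa [φ.left_inv hx]
  have hHC : ContDiffAt ℝ 1 H (φ x) := hDC.sub (P.contDiff.contDiffAt.comp _ hDC)
  obtain ⟨K, O, hO, hK⟩ := hHC.exists_lipschitzOnWith
  have hH0 : ∀ᶠ z in 𝓝 (φ x), P z ∈ φ.target → H (P z) = 0 := by
    have h1 : Tendsto (fun z => φ.symm (P z)) (𝓝 (φ x)) (𝓝 x) := by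
      have h2 : ContinuousAt (fun z => φ.symm (P z)) (φ x) :=
        ContinuousAt.comp (g := φ.symm) (by rw [hPx]; exact φ.continuousAt_symm hzt)
          P.continuous.continuousAt
      have h3 := h2.tendsto
      rwa [hPx, φ.left_inv hx] at h3
    filter_upwards [h1.eventually (eventually_nhdsWithin_iff.1 hT)] with z hz hzt
    have h2 := h.proj_fderiv (φ.map_target hzt) (h.symm_proj_mem hzt) (hz (h.symm_proj_mem hzt))
    simp only [hH, hD, h2, sub_self]
  have hγc : Tendsto γ (𝓝[≥] a) (𝓝 x) := by
    have h1 := hγ a (left_mem_Icc.2 hab.le)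
    rw [ContinuousWithinAt, nhdsWithin_Icc_eq_nhdsGE hab, hγa] at h1
    exact h1
  have hzc : Tendsto (fun s => φ (γ s)) (𝓝[≥] a) (𝓝 (φ x)) :=
    (φ.continuousAt hx).tendsto.comp hγc
  have hPc : Tendsto (fun s => P (φ (γ s))) (𝓝[≥] a) (𝓝 (φ x)) := by
    have h1 := (P.continuous.tendsto (φ x)).comp hzc
    rwa [hPx] at h1
  have hall : ∀ᶠ s in 𝓝[≥] a, γ s ∈ φ.source ∧ φ (γ s) ∈ O ∧ P (φ (γ s)) ∈ O ∧
      H (P (φ (γ s))) = 0 ∧ HasDerivWithinAt γ (V (γ s)) (Ici s) s ∧ s ∈ Icc a b := by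
    filter_upwards [hγc.eventually (φ.open_source.mem_nhds hx), hzc.eventually hO,
      hPc.eventually hO, hPc.eventually (φ.open_target.mem_nhds hzt), hzc.eventually hH0, hγ',
      Icc_mem_nhdsGE hab] with s h1 h2 h3 h4 h5 h6 h7
    exact ⟨h1, h2, h3, h5 h4, h6, h7⟩
  obtain ⟨c, hac, hc⟩ := mem_nhdsGE_iff_exists_Icc_subset.1 hall
  have key := eq_zero_of_abs_deriv_le_mul_abs_self_of_eq_zero_right (a := a) (b := c) (K := K)
    (f := fun s => φ (γ s) - P (φ (γ s))) (f' := fun s => H (φ (γ s))) ?_ ?_ ?_ ?_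
  · filter_upwards [Icc_mem_nhdsGE hac] with s hs
    rw [h.mem_iff _ (hc hs).1]
    exact (sub_eq_zero.1 (key s hs)).symm
  · have h1 : ContinuousOn (fun s => φ (γ s)) (Icc a c) :=
      φ.continuousOn.comp (hγ.mono fun s hs => (hc hs).2.2.2.2.2) fun s hs => (hc hs).1
    exact h1.sub (P.continuous.comp_continuousOn h1)
  · intro s hs
    obtain ⟨h1, -, -, -, h5, -⟩ := hc (Ico_subset_Icc_self hs)
    have h6 : HasDerivWithinAt (fun s => φ (γ s)) (D (φ (γ s))) (Ici s) s := by
      have h7 : D (φ (γ s)) = fderiv ℝ φ (γ s) (V (γ s)) := by simp only [hD, φ.left_inv h1]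
      rw [h7]
      exact (h.differentiableAt h1).hasFDerivAt.comp_hasDerivWithinAt s h5
    exact h6.sub (P.hasFDerivAt.comp_hasDerivWithinAt s h6)
  · simp [hγa, hPx]
  · intro s hs
    obtain ⟨-, h2, h3, h4, -, -⟩ := hc (Ico_subset_Icc_self hs)
    have := hK.norm_sub_le h2 h3
    rwa [h4, sub_zero] at this

end IsSliceChart

/-! ### Integral curves and transport along lifted fields -/

/-- A compactly supported `C¹` vector field has integral curves on `[0, 1]` from every point. -/
theorem exists_integralCurve_Icc {V : Type*} [NormedAddCommGroup V] [NormedSpace ℝ V]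
    [CompleteSpace V] {v : V → V} (hv : ContDiff ℝ 1 v) (hc : HasCompactSupport v) (x : V) :
    ∃ γ : ℝ → V, γ 0 = x ∧
      ∀ s ∈ Icc (0 : ℝ) 1, HasDerivWithinAt γ (v (γ s)) (Icc 0 1) s := by
  obtain ⟨K, hK⟩ := hv.lipschitzWith_of_hasCompactSupport hc one_ne_zero
  obtain ⟨C, hC⟩ := hc.exists_bound_of_continuous hv.continuous
  -- The field is globally Lipschitz, so the radius of the ball is free; taking it equal to the
  -- speed bound gives existence for unit time.
  have hPL : IsPicardLindelof (fun _ : ℝ => v) (⟨0, by simp⟩ : Icc (0 : ℝ) 1) x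
      C.toNNReal 0 C.toNNReal K :=
    { lipschitzOnWith := fun t _ => hK.lipschitzOnWith
      continuousOn := fun y _ => continuousOn_const
      norm_le := fun t _ y _ => (hC y).trans (Real.le_coe_toNNReal C)
      mul_max_le := by simp }
  exact hPL.exists_eq_forall_mem_Icc_hasDerivWithinAt₀

theorem tendsto_gronwallBound_zero {K x : ℝ} (hK : K ≠ 0) :
    Tendsto (fun q : ℝ × ℝ => gronwallBound q.1 K q.2 x) (𝓝 (0, 0)) (𝓝 0) := by
  have h : Continuous fun q : ℝ × ℝ => gronwallBound q.1 K q.2 x := by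
    simp only [gronwallBound_of_K_ne_0 hK]
    fun_prop
  have h1 := h.tendsto (0, 0)
  rwa [gronwallBound_ε0_δ0] at h1

/-- The part of `X` outside the ball of radius `r` where `ρ > R` and `f` takes values in `B`. -/
def endRegion {n p : ℕ} (X : Set (E n)) (f : E n → E p) (ρ : E n → ℝ) (r R : ℝ)
    (B : Set (E p)) : Set (E n) :=
  {x | x ∈ X ∧ r < ‖x‖ ∧ R < ρ x ∧ f x ∈ B}

/-- `A` lifts, near infinity on `X` and over `B`, the constant vector fields on `ℝᵖ` to vector
fields on `X` that are tangent to the levels of `ρ`. -/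
structure IsLift {n p : ℕ} (X : Set (E n)) (f : E n → E p) (ρ : E n → ℝ) (r R : ℝ)
    (B : Set (E p)) (A : E n → E p →L[ℝ] E n) : Prop where
  isClosed : IsClosed X
  isOpen : IsOpen B
  chart : ∀ x ∈ X, ∃ (φ : OpenPartialHomeomorph (E n) (E n)) (P : E n →L[ℝ] E n),
      x ∈ φ.source ∧ IsSliceChart X φ P
  differentiable : DifferentiableOn ℝ f X
  differentiableAt : ∀ x, r ≤ ‖x‖ → DifferentiableAt ℝ ρ x
  proper : Tendsto ρ (cocompact (E n)) atTop
  le_of_norm_eq : ∀ x, ‖x‖ = r → ρ x ≤ R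
  contDiff : ContDiff ℝ 1 A
  mem_tangentSpace : ∀ x ∈ X, r < ‖x‖ → f x ∈ B → ∀ w, A x w ∈ tangentSpace X x
  map_apply : ∀ x ∈ X, r < ‖x‖ → f x ∈ B → ∀ w, fderivWithin ℝ f X x (A x w) = w
  fderiv_apply : ∀ x ∈ X, r < ‖x‖ → f x ∈ B → ∀ w, fderiv ℝ ρ x (A x w) = 0

/-- The point `x` is moved to `y` in unit time by the lift of the constant vector field `w`. -/
def IsTransport {n p : ℕ} (X : Set (E n)) (f : E n → E p) (ρ : E n → ℝ) (r R : ℝ)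
    (B : Set (E p)) (A : E n → E p →L[ℝ] E n) (x : E n) (w : E p) (y : E n) : Prop :=
  ∃ γ : ℝ → E n, γ 0 = x ∧ γ 1 = y ∧ ∀ s ∈ Icc (0 : ℝ) 1,
    HasDerivWithinAt γ (A (γ s) w) (Icc 0 1) s ∧ γ s ∈ endRegion X f ρ r R B ∧
      ρ (γ s) = ρ x ∧ f (γ s) = f x + s • w

theorem exists_norm_lt_of_le {n : ℕ} {ρ : E n → ℝ} (hρ : Tendsto ρ (cocompact (E n)) atTop)
    (M : ℝ) : ∃ k : ℝ, 0 < k ∧ ∀ x, ρ x ≤ M → ‖x‖ < k := by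
  have h := hρ.eventually_gt_atTop M
  rw [← Metric.cobounded_eq_cocompact, ← comap_norm_atTop, eventually_comap] at h
  obtain ⟨k, hk⟩ := eventually_atTop.1 h
  refine ⟨max k 1, by positivity, fun x hx => ?_⟩
  by_contra! h1
  exact absurd (hk _ ((le_max_left _ _).trans h1) x rfl) (not_lt.2 hx)

namespace IsTransport

variable {n p : ℕ} {X : Set (E n)} {f : E n → E p} {ρ : E n → ℝ} {r R : ℝ}
  {B : Set (E p)} {A : E n → E p →L[ℝ] E n} {x y : E n} {w : E p}

theorem mem_left (h : IsTransport X f ρ r R B A x w y) : x ∈ endRegion X f ρ r R B := by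
  obtain ⟨γ, rfl, -, h⟩ := h
  exact (h 0 (by simp)).2.1

theorem mem_right (h : IsTransport X f ρ r R B A x w y) : y ∈ endRegion X f ρ r R B := by
  obtain ⟨γ, -, rfl, h⟩ := h
  exact (h 1 (by simp)).2.1

theorem map_right (h : IsTransport X f ρ r R B A x w y) : f y = f x + w := by
  obtain ⟨γ, -, rfl, h⟩ := h
  simpa using (h 1 (by simp)).2.2.2

theorem symm (h : IsTransport X f ρ r R B A x w y) : IsTransport X f ρ r R B A y (-w) x := by
  have hy := h.map_right
  obtain ⟨γ, h0, h1, h⟩ := h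
  refine ⟨fun s => γ (1 - s), by simpa using h1, by simpa using h0, fun s hs => ?_⟩
  have hs' : 1 - s ∈ Icc (0 : ℝ) 1 := ⟨by linarith [hs.2], by linarith [hs.1]⟩
  obtain ⟨hd, hm, hρ, hf⟩ := h _ hs'
  refine ⟨?_, hm, ?_, ?_⟩
  · have h2 : HasDerivWithinAt (fun s : ℝ => 1 - s) (-1) (Icc 0 1) s := by
      simpa using (hasDerivWithinAt_id s (Icc (0 : ℝ) 1)).const_sub 1
    have h3 := HasDerivWithinAt.scomp (h := fun s : ℝ => 1 - s) s hd h2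
      (fun t ht => ⟨by linarith [ht.2], by linarith [ht.1]⟩)
    have h4 : A (γ (1 - s)) (-w) = (-1 : ℝ) • A (γ (1 - s)) w := by simp
    rw [h4]
    exact h3
  · rw [hρ, ← h1, (h 1 (by simp)).2.2.1]
  · rw [hf, hy, sub_smul, one_smul, smul_neg]
    abel

end IsTransport

namespace IsLift

variable {n p : ℕ} {X : Set (E n)} {f : E n → E p} {ρ : E n → ℝ} {r R : ℝ}
  {B : Set (E p)} {A : E n → E p →L[ℝ] E n}

/-- The transport depends continuously on the starting point and on the direction. -/
theorem dist_transport_lt (hA : IsLift X f ρ r R B A) {x₀ y₀ : E n} {w₀ : E p}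
    (h₀ : IsTransport X f ρ r R B A x₀ w₀ y₀) {ε : ℝ} (hε : 0 < ε) :
    ∀ᶠ q : E n × E p in 𝓝 (x₀, w₀), ∀ y, IsTransport X f ρ r R B A q.1 q.2 y → dist y y₀ < ε := by
  -- The `+ 1` makes one ball contain the curves from all nearby starting points, since `ρ` is
  -- constant along each of them.
  obtain ⟨k, hk0, hk⟩ := exists_norm_lt_of_le hA.proper (ρ x₀ + 1)
  obtain ⟨K, hK⟩ := hA.contDiff.contDiffOn.exists_lipschitzOnWith one_ne_zero
    (convex_closedBall (0 : E n) k) (isCompact_closedBall 0 k)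
  obtain ⟨C, hC⟩ := (isCompact_closedBall (0 : E n) k).exists_bound_of_continuousOn
    hA.contDiff.continuous.continuousOn
  -- The `+ 1` keeps the constant nonzero, so that a single formula for `gronwallBound` applies.
  set L : NNReal := K * ‖w₀‖₊ + 1 with hL
  have hL0 : (L : ℝ) ≠ 0 := by positivity
  have hLip : LipschitzOnWith L (fun z => A z w₀) (Metric.closedBall 0 k) := by
    refine LipschitzOnWith.of_dist_le_mul fun a ha b hb => ?_
    have h1 := hK.dist_le_mul a ha b hb
    rw [dist_eq_norm] at h1 ⊢
    calc ‖A a w₀ - A b w₀‖ = ‖(A a - A b) w₀‖ := by simp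
      _ ≤ ‖A a - A b‖ * ‖w₀‖ := (A a - A b).le_opNorm w₀
      _ ≤ (K * dist a b) * ‖w₀‖ := by gcongr
      _ ≤ L * dist a b := by
        have : (L : ℝ) = K * ‖w₀‖ + 1 := by simp [hL]
        rw [this]
        nlinarith [dist_nonneg (x := a) (y := b)]
  have hρx : ContinuousAt ρ x₀ := (hA.differentiableAt x₀ h₀.mem_left.2.1.le).continuousAt
  have hq : Tendsto (fun q : E n × E p => gronwallBound (dist q.1 x₀) L (C * dist q.2 w₀) 1)
      (𝓝 (x₀, w₀)) (𝓝 0) := by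
    have h1 : Continuous fun q : E n × E p => (dist q.1 x₀, C * dist q.2 w₀) := by fun_prop
    have h2 := h1.tendsto (x₀, w₀)
    rw [dist_self, dist_self, mul_zero] at h2
    exact (tendsto_gronwallBound_zero (x := 1) hL0).comp h2
  have hρe : ∀ᶠ q : E n × E p in 𝓝 (x₀, w₀), ρ q.1 < ρ x₀ + 1 :=
    (hρx.comp continuousAt_fst).eventually (gt_mem_nhds (by simp))
  obtain ⟨γ₀, h00, h01, hγ₀⟩ := h₀
  filter_upwards [hq.eventually (gt_mem_nhds hε), hρe]
  rintro ⟨x, w⟩ h1 h2 y ⟨γ, hγ0, hγ1, hγ⟩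
  have hmem : ∀ s ∈ Icc (0 : ℝ) 1, γ s ∈ Metric.closedBall (0 : E n) k := fun s hs => by
    rw [mem_closedBall_zero_iff]
    exact (hk _ ((hγ s hs).2.2.1.le.trans h2.le)).le
  have hmem₀ : ∀ s ∈ Icc (0 : ℝ) 1, γ₀ s ∈ Metric.closedBall (0 : E n) k := fun s hs => by
    rw [mem_closedBall_zero_iff]
    exact (hk _ (by rw [(hγ₀ s hs).2.2.1]; simp)).le
  -- The curve in direction `w` is an approximate solution for `w₀`, with error at most `C * dist w
  -- w₀`.
  have key := dist_le_of_approx_trajectories_ODE_of_mem (a := 0) (b := 1) (f := γ) (g := γ₀)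
    (v := fun _ z => A z w₀) (s := fun _ => Metric.closedBall 0 k) (K := L)
    (f' := fun s => A (γ s) w) (g' := fun s => A (γ₀ s) w₀) (εf := C * dist w w₀) (εg := 0)
    (δ := dist x x₀) (fun _ _ => hLip)
    (fun s hs => (hγ s hs).1.continuousWithinAt)
    (fun s hs => (hγ s (Ico_subset_Icc_self hs)).1.mono_of_mem_nhdsWithin
      (Icc_mem_nhdsGE_of_mem hs)) ?_ (fun s hs => hmem s (Ico_subset_Icc_self hs))
    (fun s hs => (hγ₀ s hs).1.continuousWithinAt)
    (fun s hs => (hγ₀ s (Ico_subset_Icc_self hs)).1.mono_of_mem_nhdsWithin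
      (Icc_mem_nhdsGE_of_mem hs)) (by simp)
    (fun s hs => hmem₀ s (Ico_subset_Icc_self hs)) (by simp [hγ0, h00]) 1 (by simp)
  · rw [hγ1, h01, add_zero, sub_zero] at key
    exact key.trans_lt h1
  · intro s hs
    simp only [dist_eq_norm]
    rw [← map_sub]
    exact ((A (γ s)).le_opNorm _).trans
      (by gcongr; exact hC _ (hmem s (Ico_subset_Icc_self hs)))

/-- The continuity estimate bounds every endpoint, so it may be applied at the base pair itself with
`ε = dist y' y`. -/
theorem transport_unique (hA : IsLift X f ρ r R B A) {x y y' : E n} {w : E p}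
    (h : IsTransport X f ρ r R B A x w y) (h' : IsTransport X f ρ r R B A x w y') : y' = y := by
  by_contra hne
  exact absurd ((hA.dist_transport_lt h (dist_pos.2 hne)).self_of_nhds y' h') (lt_irrefl _)

/-- The lift of a constant vector field can be integrated up to unit time as long as the
straight path of the values of `f` stays in `B`. -/
theorem exists_transport (hA : IsLift X f ρ r R B A) {x : E n}
    (hx : x ∈ endRegion X f ρ r R B) {w : E p} (hw : ∀ s ∈ Icc (0 : ℝ) 1, f x + s • w ∈ B) :
    ∃ y, IsTransport X f ρ r R B A x w y := by
  obtain ⟨k, hk0, hk⟩ := exists_norm_lt_of_le hA.proper (ρ x)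
  -- The cutoff gives a compactly supported field without changing it where `ρ ≤ ρ x`, which is
  -- where the curve will turn out to stay.
  let χ : ContDiffBump (0 : E n) := ⟨k, k + 1, hk0, by linarith⟩
  set v : E n → E n := fun z => χ z • A z w with hv
  have hvC : ContDiff ℝ 1 v := χ.contDiff.smul (hA.contDiff.clm_apply contDiff_const)
  have hvA : ∀ z, ‖z‖ < k → v z = A z w := fun z hz => by
    have : χ z = 1 := χ.one_of_mem_closedBall (by simpa using hz.le)
    simp [hv, this]
  obtain ⟨γ, hγ0, hγ⟩ := exists_integralCurve_Icc hvC (χ.hasCompactSupport.smul_right) x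
  have hγc : ContinuousOn γ (Icc 0 1) := fun s hs => (hγ s hs).continuousWithinAt
  -- Continuous induction on the good times. The inequality `r ≤ ‖γ s‖` is weak to make the set
  -- closed; `hreg` recovers the strict one, since `ρ ≤ R` on the sphere of radius `r`.
  set S : Set ℝ := {s | (γ s ∈ X ∧ r ≤ ‖γ s‖) ∧ (ρ (γ s), f (γ s) - s • w) = (ρ x, f x)} with hS
  have hreg : ∀ s ∈ S, s ∈ Icc (0 : ℝ) 1 → γ s ∈ endRegion X f ρ r R B := by
    rintro s ⟨⟨h1, h2⟩, h3⟩ hs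
    rw [Prod.mk.injEq] at h3
    have h4 : R < ρ (γ s) := by rw [h3.1]; exact hx.2.2.1
    refine ⟨h1, lt_of_le_of_ne h2 fun h5 => ?_, h4, ?_⟩
    · exact absurd (hA.le_of_norm_eq _ h5.symm) (not_le.2 h4)
    · rw [sub_eq_iff_eq_add.1 h3.2]
      exact hw s hs
  have hclosed : IsClosed (S ∩ Icc 0 1) := by
    have h1 : IsClosed (Icc (0 : ℝ) 1 ∩ γ ⁻¹' (X ∩ {z | r ≤ ‖z‖})) :=
      hγc.preimage_isClosed_of_isClosed isClosed_Icc
        (hA.isClosed.inter (isClosed_le continuous_const continuous_norm))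
    have h2 : ContinuousOn (fun s => (ρ (γ s), f (γ s) - s • w))
        (Icc (0 : ℝ) 1 ∩ γ ⁻¹' (X ∩ {z | r ≤ ‖z‖})) := by
      refine ContinuousOn.prodMk ?_ (ContinuousOn.sub ?_ (by fun_prop))
      · exact ContinuousOn.comp (t := {z | r ≤ ‖z‖}) (fun z hz =>
          (hA.differentiableAt z hz).continuousAt.continuousWithinAt)
          (hγc.mono inter_subset_left) fun s hs => hs.2.2
      · exact hA.differentiable.continuousOn.comp (hγc.mono inter_subset_left)
          fun s hs => hs.2.1
    have h3 := h2.preimage_isClosed_of_isClosed h1 (isClosed_singleton (x := (ρ x, f x)))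
    convert h3 using 1
    ext s
    simp only [hS, mem_inter_iff, mem_ofPred_eq, mem_preimage, mem_singleton_iff]
    tauto
  have h0 : (0 : ℝ) ∈ S := by
    simp [hS, hγ0, hx.1, hx.2.1.le]
  have hsub : Icc (0 : ℝ) 1 ⊆ S := by
    refine hclosed.Icc_subset_of_forall_mem_nhdsWithin h0 ?_
    rintro a ⟨haS, ha⟩
    have ham := hreg a haS (Ico_subset_Icc_self ha)
    have hak : ‖γ a‖ < k := hk _ (by rw [(Prod.mk.inj haS.2).1])
    have hγr : ∀ s ∈ Ico (0 : ℝ) 1, HasDerivWithinAt γ (v (γ s)) (Ici s) s := fun s hs =>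
      (hγ s (Ico_subset_Icc_self hs)).mono_of_mem_nhdsWithin (Icc_mem_nhdsGE_of_mem hs)
    have hγa : Tendsto γ (𝓝[≥] a) (𝓝 (γ a)) := (hγr a ha).continuousWithinAt
    have hnear : ∀ᶠ z in 𝓝[X] (γ a), r < ‖z‖ ∧ f z ∈ B := by
      filter_upwards [mem_nhdsWithin_of_mem_nhds
        (continuous_norm.continuousAt.eventually (lt_mem_nhds ham.2.1)),
        (hA.differentiable.continuousOn _ ham.1).eventually (hA.isOpen.mem_nhds ham.2.2.2)]
        with z h1 h2 using ⟨h1, h2⟩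
    have hk' : ∀ᶠ z in 𝓝 (γ a), ‖z‖ < k :=
      continuous_norm.continuousAt.eventually (gt_mem_nhds hak)
    have hT : ∀ᶠ z in 𝓝[X] (γ a), v z ∈ tangentSpace X z := by
      filter_upwards [hnear, self_mem_nhdsWithin, mem_nhdsWithin_of_mem_nhds hk']
        with z h1 h2 h3
      rw [hvA z h3]
      exact hA.mem_tangentSpace z h2 h1.1 h1.2 w
    have hIco : ∀ᶠ s in 𝓝[≥] a, s ∈ Ico (0 : ℝ) 1 := by
      filter_upwards [Ico_mem_nhdsGE ha.2] with s hs using ⟨ha.1.trans hs.1, hs.2⟩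
    obtain ⟨φ, P, hφ, hP⟩ := hA.chart _ ham.1
    have hX : ∀ᶠ s in 𝓝[≥] a, γ s ∈ X :=
      hP.eventually_mem_of_tangent hφ ham.1 hvC.contDiffAt hT ha.2
        (hγc.mono (Icc_subset_Icc_left ha.1)) rfl (hIco.mono hγr)
    have hγX : Tendsto γ (𝓝[≥] a) (𝓝[X] (γ a)) := tendsto_nhdsWithin_iff.2 ⟨hγa, hX⟩
    have hall : ∀ᶠ s in 𝓝[≥] a, γ s ∈ X ∧ (r < ‖γ s‖ ∧ f (γ s) ∈ B) ∧ ‖γ s‖ < k ∧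
        s ∈ Ico (0 : ℝ) 1 := by
      filter_upwards [hX, hγX.eventually hnear, hγa.eventually hk', hIco] with s h1 h2 h3 h4
        using ⟨h1, h2, h3, h4⟩
    obtain ⟨c, hac, hc⟩ := mem_nhdsGE_iff_exists_Icc_subset.1 hall
    have hγ' : ∀ s ∈ Ico a c, HasDerivWithinAt γ (A (γ s) w) (Icc s c) s := fun s hs => by
      obtain ⟨h1, -, h3, h4⟩ := hc (Ico_subset_Icc_self hs)
      have := (hγr s h4).mono (Icc_subset_Ici_self : Icc s c ⊆ Ici s)
      rwa [hvA _ h3] at this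
    have hcc : ContinuousOn γ (Icc a c) := hγc.mono fun s hs =>
      Ico_subset_Icc_self (hc hs).2.2.2
    have hρ0 := constant_of_has_deriv_right_zero (f := fun s => ρ (γ s)) (a := a) (b := c)
      (ContinuousOn.comp (t := {z | r ≤ ‖z‖}) (fun z hz =>
          (hA.differentiableAt z hz).continuousAt.continuousWithinAt) hcc
          fun s hs => (hc hs).2.1.1.le) (fun s hs => by
        obtain ⟨h1, h2, h3, h4⟩ := hc (Ico_subset_Icc_self hs)
        have h5 := (hA.differentiableAt _ h2.1.le).hasFDerivAt.comp_hasDerivWithinAt s (hγ' s hs)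
        rw [hA.fderiv_apply _ h1 h2.1 h2.2] at h5
        exact h5.mono_of_mem_nhdsWithin (Icc_mem_nhdsGE hs.2))
    have hf0 := constant_of_has_deriv_right_zero (f := fun s => f (γ s) - s • w) (a := a) (b := c)
      ((hA.differentiable.continuousOn.comp hcc fun s hs => (hc hs).1).sub (by fun_prop))
      (fun s hs => by
        obtain ⟨h1, h2, h3, h4⟩ := hc (Ico_subset_Icc_self hs)
        -- `f` is differentiable only within `X`, so the chain rule needs the curve to be already
        -- known to stay in `X`.
        have h5 := (hA.differentiable _ h1).hasFDerivWithinAt.comp_hasDerivWithinAt s (hγ' s hs)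
          (fun t ht => (hc ⟨hs.1.trans ht.1, ht.2⟩).1)
        rw [hA.map_apply _ h1 h2.1 h2.2] at h5
        have h6 := h5.sub (((hasDerivWithinAt_id s (Icc s c))).smul_const w)
        rw [one_smul, sub_self] at h6
        exact h6.mono_of_mem_nhdsWithin (Icc_mem_nhdsGE hs.2))
    filter_upwards [Ioc_mem_nhdsGT hac] with s hs
    have hs' := Ioc_subset_Icc_self hs
    obtain ⟨h1, h2, -, -⟩ := hc hs'
    exact ⟨⟨h1, h2.1.le⟩, by rw [Prod.mk.injEq, hρ0 s hs', hf0 s hs']; exact Prod.mk.inj haS.2⟩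
  refine ⟨γ 1, γ, hγ0, rfl, fun s hs => ?_⟩
  have hsS := hsub hs
  obtain ⟨h1, h2⟩ := Prod.mk.inj hsS.2
  refine ⟨?_, hreg s hsS hs, h1, ?_⟩
  · have := hγ s hs
    rwa [hvA _ (hk _ h1.le)] at this
  · rw [sub_eq_iff_eq_add.1 h2]

end IsLift

/-! ### Global lifting by a partition of unity -/

section Lift

variable {n p d : ℕ} {X : Set (E n)} {f : E n → E p} {ρ : E n → ℝ}

/-- If `(f, ρ)` is a submersion along the closed subset `Z` of `X`, then the constant vector fields
on `ℝᵖ` lift globally, over `Z`, to fields tangent to `X` and to the levels of `ρ`. -/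
theorem exists_contDiff_lift (hX : IsC2Submanifold d X) (hf : ContDiffOn ℝ 2 f X)
    {Z : Set (E n)} (hZ : IsClosed Z) (hZX : Z ⊆ X) (hρ : ∀ x ∈ Z, ContDiffAt ℝ 2 ρ x)
    (hsurj : ∀ x ∈ Z, ∀ w : E p × ℝ, ∃ v ∈ tangentSpace X x,
      (fderivWithin ℝ f X x v, fderiv ℝ ρ x v) = w) :
    ∃ A : E n → E p →L[ℝ] E n, ContDiff ℝ 1 A ∧ ∀ x ∈ Z, ∀ w, A x w ∈ tangentSpace X x ∧
      fderivWithin ℝ f X x (A x w) = w ∧ fderiv ℝ ρ x (A x w) = 0 := by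
  -- The conditions on `L` are affine, hence preserved by the convex combinations of a partition of
  -- unity; off `Z` nothing is required.
  let t : E n → Set (E p →L[ℝ] E n) := fun x => {L | x ∈ Z → ∀ w, L w ∈ tangentSpace X x ∧
    fderivWithin ℝ f X x (L w) = w ∧ fderiv ℝ ρ x (L w) = 0}
  have hconv : ∀ x, Convex ℝ (t x) := by
    intro x L hL M hM a b ha hb hab hx w
    obtain ⟨h1, h2, h3⟩ := hL hx w
    obtain ⟨h4, h5, h6⟩ := hM hx w
    refine ⟨?_, ?_, ?_⟩
    · exact Submodule.add_mem _ (Submodule.smul_mem _ _ h1) (Submodule.smul_mem _ _ h4)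
    · simp only [add_apply, smul_apply, map_add,
        map_smul, h2, h5]
      rw [← add_smul, hab, one_smul]
    · simp [h3, h6]
  have hloc : ∀ x, ∃ U ∈ 𝓝 x, ∃ A : E n → E p →L[ℝ] E n,
      ContMDiffOn (modelWithCornersSelf ℝ (E n)) (modelWithCornersSelf ℝ (E p →L[ℝ] E n)) 1 A U ∧
        ∀ y ∈ U, A y ∈ t y := by
    intro x
    by_cases hx : x ∈ Z
    · obtain ⟨φ, P, hxφ, hP⟩ := hX.exists_isSliceChart (hZX hx)
      obtain ⟨A, hAC, hA⟩ := hP.exists_local_lift hxφ (hZX hx) (g := fun y => (f y, ρ y))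
        (g' := fun y => (fderivWithin ℝ f X y).prod (fderiv ℝ ρ y))
        ((hf x (hZX hx)).prodMk (hρ x hx).contDiffWithinAt) (by
          have h1 : ∀ᶠ y in 𝓝 x, DifferentiableAt ℝ ρ y := by
            filter_upwards [(hρ x hx).eventually (by simp)] with y hy
              using hy.differentiableAt (by norm_num)
          filter_upwards [mem_nhdsWithin_of_mem_nhds h1, self_mem_nhdsWithin] with y hy hyX
          exact ((hf.differentiableOn (by norm_num)) y hyX).hasFDerivWithinAt.prodMk
            hy.hasFDerivAt.hasFDerivWithinAt) (hsurj x hx)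
      obtain ⟨U, hU, hAU⟩ := hAC.contDiffOn (m := 1) le_rfl (by simp)
      refine ⟨U ∩ {y | y ∈ X → ∀ w, A y w ∈ tangentSpace X y ∧
        (fderivWithin ℝ f X y).prod (fderiv ℝ ρ y) (A y w) = w},
        inter_mem (by simpa using hU) (eventually_nhdsWithin_iff.1 hA),
        fun y => A y ∘L ContinuousLinearMap.inl ℝ (E p) ℝ,
        ((hAU.clm_comp contDiffOn_const).mono inter_subset_left).contMDiffOn, ?_⟩
      rintro y ⟨-, hy⟩ hyZ w
      obtain ⟨h1, h2⟩ := hy (hZX hyZ) (w, 0)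
      obtain ⟨h3, h4⟩ := Prod.mk.inj h2
      exact ⟨h1, h3, h4⟩
    · exact ⟨Zᶜ, hZ.isOpen_compl.mem_nhds hx, 0, contMDiffOn_const, fun y hy hyZ => absurd hyZ hy⟩
  obtain ⟨A, hA⟩ := exists_contMDiffMap_forall_mem_convex_of_local (n := 1)
    (modelWithCornersSelf ℝ (E n)) hconv hloc
  exact ⟨A, A.contMDiff.contDiff, hA⟩

end Lift

/-! ### The trivialisation -/

section Trivial

variable {n p : ℕ} {X : Set (E n)} {f : E n → E p} {ρ : E n → ℝ} {r R δ : ℝ} {t₀ : E p}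
  {A : E n → E p →L[ℝ] E n}

/-- Send `x` to `f x` and its transport by `t₀ - f x`; the inverse transports `y` by `b - t₀`.
Reversed curves and uniqueness of transport show that these are mutually inverse. -/
theorem IsLift.isHomeomorphicTrivialFiberBundle
    (hA : IsLift X f ρ r R (Metric.ball t₀ δ) A) {C : Set (E n)}
    (hC : ∀ x, x ∉ C ↔ r < ‖x‖ ∧ R < ρ x) (hδ : 0 < δ) :
    IsHomeomorphicTrivialFiberBundle
      {x // x ∈ endRegion X f ρ r R (Metric.ball t₀ δ) ∧ f x = t₀}
      (MapsTo.restrict f ((X \ C) ∩ f ⁻¹' Metric.ball t₀ δ) (Metric.ball t₀ δ)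
        (fun _ hx => hx.2)) := by
  have hmem : ∀ x, x ∈ (X \ C) ∩ f ⁻¹' Metric.ball t₀ δ ↔
      x ∈ endRegion X f ρ r R (Metric.ball t₀ δ) := fun x => by
    simp only [mem_inter_iff, Set.mem_sdiff, hC, mem_preimage, endRegion, mem_ofPred_eq]
    tauto
  have hex : ∀ x w, ∃ y, x ∈ endRegion X f ρ r R (Metric.ball t₀ δ) →
      f x + w ∈ Metric.ball t₀ δ → IsTransport X f ρ r R (Metric.ball t₀ δ) A x w y := by
    intro x w
    by_cases h : x ∈ endRegion X f ρ r R (Metric.ball t₀ δ) ∧ f x + w ∈ Metric.ball t₀ δ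
    · obtain ⟨y, hy⟩ := hA.exists_transport h.1 (w := w)
        (fun s hs => (convex_ball t₀ δ).add_smul_mem h.1.2.2.2 h.2 hs)
      exact ⟨y, fun _ _ => hy⟩
    · exact ⟨x, fun h1 h2 => absurd ⟨h1, h2⟩ h⟩
  choose Φ hΦ using hex
  have hcont : ContinuousOn (fun q : E n × E p => Φ q.1 q.2)
      {q | q.1 ∈ endRegion X f ρ r R (Metric.ball t₀ δ) ∧ f q.1 + q.2 ∈ Metric.ball t₀ δ} := by
    rintro ⟨x, w⟩ ⟨hx, hw⟩
    refine Metric.tendsto_nhds.2 fun ε hε => ?_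
    filter_upwards [mem_nhdsWithin_of_mem_nhds (hA.dist_transport_lt (hΦ x w hx hw) hε),
      self_mem_nhdsWithin] with q hq hq' using hq _ (hΦ _ _ hq'.1 hq'.2)
  have ht₀ : t₀ ∈ Metric.ball t₀ δ := Metric.mem_ball_self hδ
  have hto : ∀ x, x ∈ endRegion X f ρ r R (Metric.ball t₀ δ) →
      IsTransport X f ρ r R (Metric.ball t₀ δ) A x (t₀ - f x) (Φ x (t₀ - f x)) :=
    fun x hx => hΦ _ _ hx (by simpa using ht₀)
  have hinv : ∀ y, y ∈ endRegion X f ρ r R (Metric.ball t₀ δ) → f y = t₀ →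
      ∀ b ∈ Metric.ball t₀ δ,
        IsTransport X f ρ r R (Metric.ball t₀ δ) A y (b - t₀) (Φ y (b - t₀)) :=
    fun y hy hy' b hb => hΦ _ _ hy (by simpa [hy'] using hb)
  have hfc : Continuous fun x : ((X \ C) ∩ f ⁻¹' Metric.ball t₀ δ : Set (E n)) => f x :=
    continuousOn_iff_continuous_domRestrict.1
      (hA.differentiable.continuousOn.mono fun x hx => hx.1.1)
  refine ⟨{
    toFun := fun x => (⟨f x, x.2.2⟩, ⟨Φ x (t₀ - f x), (hto x ((hmem x).1 x.2)).mem_right, by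
      rw [(hto x ((hmem x).1 x.2)).map_right]; abel⟩)
    invFun := fun q => ⟨Φ q.2 (q.1 - t₀), (hmem _).2
      (hinv q.2 q.2.2.1 q.2.2.2 q.1 q.1.2).mem_right⟩
    left_inv := fun x => ?_
    right_inv := fun q => ?_
    continuous_toFun := ?_
    continuous_invFun := ?_ }, fun x => rfl⟩
  · have hx := (hmem x).1 x.2
    have h1 := hto x hx
    have h2 := h1.symm
    rw [neg_sub] at h2
    exact Subtype.ext (hA.transport_unique h2
      (hinv _ h1.mem_right (by rw [h1.map_right]; abel) _ x.2.2))
  · obtain ⟨⟨b, hb⟩, ⟨y, hy, hyt⟩⟩ := q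
    have h1 := hinv y hy hyt b hb
    have hfy : f (Φ y (b - t₀)) = b := by rw [h1.map_right, hyt]; abel
    have h2 := h1.symm
    rw [neg_sub] at h2
    have h3 := hto _ h1.mem_right
    rw [hfy] at h3
    refine Prod.ext (Subtype.ext hfy) (Subtype.ext ?_)
    simp only [hfy]
    exact hA.transport_unique h2 h3
  · refine Continuous.prodMk (Continuous.subtype_mk hfc _) (Continuous.subtype_mk ?_ _)
    exact hcont.comp_continuous (continuous_subtype_val.prodMk (continuous_const.sub hfc))
      fun x => ⟨(hmem x).1 x.2, by simpa using ht₀⟩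
  · refine Continuous.subtype_mk ?_ _
    refine hcont.comp_continuous (f := fun q : (Metric.ball t₀ δ) ×
      {x // x ∈ endRegion X f ρ r R (Metric.ball t₀ δ) ∧ f x = t₀} =>
        ((q.2 : E n), (q.1 : E p) - t₀)) (by fun_prop) fun q => ⟨q.2.2.1, ?_⟩
    simp [q.2.2.2]

end Trivial

/-! ### Conclusion from the asymptotic conditions -/

section Main

variable {n p d : ℕ} {K : Set (E n)} {ρ : E n → ℝ} {X : Set (E n)} {f : E n → E p}

/-- Away from the asymptotic nonregular values there are no Milnor points near infinity. -/
theorem exists_forall_notMem_milnorSet {t₀ : E p}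
    (ht₀ : t₀ ∉ asymptoticNonregularValues K ρ X f) :
    ∃ r : ℝ, ∃ δ > 0, ∀ x, r ≤ ‖x‖ → dist (f x) t₀ ≤ δ → x ∉ milnorSet K ρ X f := by
  by_contra! h
  choose x hx using fun j : ℕ => h j (1 / ((j : ℝ) + 1)) (by positivity)
  refine ht₀ ⟨x, fun j => (hx j).2.2, ?_, ?_⟩
  · exact tendsto_atTop_mono (fun j => (hx j).1) tendsto_natCast_atTop_atTop
  · rw [tendsto_iff_dist_tendsto_zero]
    exact squeeze_zero (fun _ => dist_nonneg) (fun j => (hx j).2.1)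
      tendsto_one_div_add_atTop_nhds_zero_nat

theorem topTrivialAtInfinity_of_notMem (hρ : IsProperSubmersionOff K ρ)
    (hX : IsC2Submanifold d X) (hXc : IsClosed X) (hf : ContDiffOn ℝ 2 f X) {t₀ : E p}
    (ht₀ : t₀ ∉ asymptoticNonregularValues K ρ X f) : TopTrivialAtInfinity X f t₀ := by
  obtain ⟨r₀, δ, hδ, hM⟩ := exists_forall_notMem_milnorSet ht₀
  obtain ⟨k, hk⟩ := hρ.isCompact.isBounded.exists_norm_le
  -- Beyond `k + 1` the set `K` is avoided, so `ρ` is analytic on the whole closed exterior region.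
  set r : ℝ := max r₀ (k + 1) with hr
  have hKr : ∀ x : E n, r ≤ ‖x‖ → x ∉ K := fun x hx hxK => by
    have := hk x hxK
    have := le_max_right r₀ (k + 1)
    linarith
  have han : ∀ x : E n, r ≤ ‖x‖ → ContDiffAt ℝ 2 ρ x := fun x hx =>
    (hρ.analytic x (hKr x hx)).contDiffAt
  have hρc : ContinuousOn ρ {x | r ≤ ‖x‖} := fun x hx =>
    (han x hx).continuousAt.continuousWithinAt
  obtain ⟨R, hR⟩ : ∃ R : ℝ, ∀ x : E n, ‖x‖ = r → ρ x ≤ R := by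
    obtain ⟨R, hR⟩ := (isCompact_sphere (0 : E n) r).exists_bound_of_continuousOn
      (hρc.mono fun x hx => by simp [mem_sphere_zero_iff_norm.1 hx])
    exact ⟨R, fun x hx => (le_abs_self _).trans (hR x (by simpa using hx))⟩
  obtain ⟨A, hAC, hA⟩ := exists_contDiff_lift hX hf (ρ := ρ)
    (Z := X ∩ {x | r ≤ ‖x‖ ∧ dist (f x) t₀ ≤ δ}) (by
      have h1 : IsClosed (X ∩ f ⁻¹' Metric.closedBall t₀ δ) :=
        hf.continuousOn.preimage_isClosed_of_isClosed hXc Metric.isClosed_closedBall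
      have h2 : IsClosed {x : E n | r ≤ ‖x‖} := isClosed_le continuous_const continuous_norm
      convert h1.inter h2 using 1
      ext x
      simp only [mem_inter_iff, mem_ofPred_eq, mem_preimage, Metric.mem_closedBall]
      tauto) inter_subset_left (fun x hx => han x hx.2.1) (fun x hx => by
      have h1 := hM x ((le_max_left _ _).trans hx.2.1) hx.2.2
      by_contra h2
      exact h1 ⟨hx.1, hKr x hx.2.1, h2⟩)
  have hlift : IsLift X f ρ r R (Metric.ball t₀ δ) A :=
    { isClosed := hXc
      isOpen := Metric.isOpen_ball
      chart := fun x hx => hX.exists_isSliceChart hx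
      differentiable := hf.differentiableOn (by norm_num)
      differentiableAt := fun x hx => (han x hx).differentiableAt (by norm_num)
      proper := hρ.proper
      le_of_norm_eq := hR
      contDiff := hAC
      mem_tangentSpace := fun x h1 h2 h3 w => (hA x ⟨h1, h2.le, (Metric.mem_ball.1 h3).le⟩ w).1
      map_apply := fun x h1 h2 h3 w => (hA x ⟨h1, h2.le, (Metric.mem_ball.1 h3).le⟩ w).2.1
      fderiv_apply := fun x h1 h2 h3 w => (hA x ⟨h1, h2.le, (Metric.mem_ball.1 h3).le⟩ w).2.2 }
  -- This set is bounded by properness of `ρ`. It is closed although `ρ` is controlled only where `r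
  -- ≤ ‖x‖`, because the ball already covers the rest.
  refine ⟨{x | ‖x‖ ≤ r ∨ ρ x ≤ R}, ?_, δ, hδ, _, inferInstance,
    hlift.isHomeomorphicTrivialFiberBundle (fun x => by simp) hδ⟩
  obtain ⟨m, -, hm⟩ := exists_norm_lt_of_le hρ.proper R
  refine Metric.isCompact_of_isClosed_isBounded ?_ ?_
  · have h1 : IsClosed ({x : E n | r ≤ ‖x‖} ∩ ρ ⁻¹' Iic R) :=
      hρc.preimage_isClosed_of_isClosed (isClosed_le continuous_const continuous_norm) isClosed_Iic
    have h2 : IsClosed {x : E n | ‖x‖ ≤ r} := isClosed_le continuous_norm continuous_const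
    have h3 : {x : E n | ‖x‖ ≤ r ∨ ρ x ≤ R} =
        {x : E n | ‖x‖ ≤ r} ∪ {x : E n | r ≤ ‖x‖} ∩ ρ ⁻¹' Iic R := by
      ext x
      simp only [mem_ofPred_eq, mem_union, mem_inter_iff, mem_preimage, mem_Iic]
      have := le_total r ‖x‖
      tauto
    rw [h3]
    exact h2.union h1
  · refine (Metric.isBounded_closedBall (x := (0 : E n)) (r := max r m)).subset fun x hx => ?_
    rw [mem_closedBall_zero_iff]
    rcases hx with hx | hx
    · exact hx.trans (le_max_left _ _)
    · exact (hm x hx).le.trans (le_max_right _ _)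

/-- Transversality of the fibre of `f` to the level of `ρ` makes `(f, ρ)` a submersion. -/
theorem TransversalAt.exists_eq {x : E n} (h : TransversalAt ρ X f x)
    (hs : Function.Surjective (fderiv ℝ ρ x)) (w : E p × ℝ) :
    ∃ v ∈ tangentSpace X x, (fderivWithin ℝ f X x v, fderiv ℝ ρ x v) = w := by
  obtain ⟨v, hv, hvw⟩ := h.1 w.1
  -- The lift `v` of `w.1` has the wrong `ρ`-derivative; the fibre-tangent part of `u` corrects it
  -- without affecting that of `f`.
  obtain ⟨u, hu⟩ := hs (w.2 - fderiv ℝ ρ x v)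
  have hutop : u ∈ fibreTangentSpace X f x ⊔ levelTangentSpace ρ x := by rw [h.2]; trivial
  obtain ⟨a, ha, b, hb, rfl⟩ := Submodule.mem_sup.1 hutop
  have hb' : fderiv ℝ ρ x b = 0 := hb
  have ha' : fderivWithin ℝ f X x a = 0 := ha.2
  rw [map_add, hb', add_zero] at hu
  exact ⟨v + a, Submodule.add_mem _ hv ha.1, Prod.ext (by simp [hvw, ha']) (by simp [hu])⟩

/-- Rescaling gives `[1 : x] = [1/‖x‖ : x/‖x‖]`, whose representatives converge to `(0, v)`. -/
theorem tendsto_affineChart {x : ℕ → E n} {v : E n} (hv : v ≠ 0)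
    (hx : Tendsto (fun j => ‖x j‖) atTop atTop)
    (hxv : Tendsto (fun j => ‖x j‖⁻¹ • x j) atTop (𝓝 v)) :
    Tendsto (fun j => affineChart (x j)) atTop
      (𝓝 (Projectivization.mk ℝ ((0, v) : ℝ × E n) (by simp [hv]) : ProjSpace n)) := by
  let π : {u : ℝ × E n // u ≠ 0} → ProjSpace n := fun u => Projectivization.mk ℝ u.1 u.2
  have hc : Continuous π := continuous_coinduced_rng
  have h0 : ∀ᶠ j in atTop, x j ≠ 0 := by
    filter_upwards [hx.eventually_gt_atTop 0] with j hj using norm_pos_iff.1 hj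
  let u : ℕ → {u : ℝ × E n // u ≠ 0} := fun j =>
    if h : x j = 0 then ⟨(1, 0), by simp⟩ else ⟨(‖x j‖⁻¹, ‖x j‖⁻¹ • x j), by simp [h]⟩
  have hu : Tendsto u atTop (𝓝 ⟨((0, v) : ℝ × E n), by simp [hv]⟩) := by
    rw [tendsto_subtype_rng]
    refine (hx.inv_tendsto_atTop.prodMk_nhds hxv).congr' ?_
    filter_upwards [h0] with j hj
    simp [u, hj]
  refine ((hc.tendsto _).comp hu).congr' ?_
  filter_upwards [h0] with j hj
  simp only [Function.comp, u, hj, dif_neg, not_false_eq_true, affineChart, π]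
  exact (Projectivization.mk_eq_mk_iff' ℝ _ _ _ _).2 ⟨‖x j‖⁻¹, by simp⟩

theorem FibreRhoRegularAtInfinity.notMem (hρ : IsProperSubmersionOff K ρ) {t₀ : E p}
    (h : FibreRhoRegularAtInfinity K ρ X f t₀) : t₀ ∉ asymptoticNonregularValues K ρ X f := by
  rintro ⟨x, hxM, hx, hfx⟩
  have hball : ∀ j, ‖x j‖⁻¹ • x j ∈ Metric.closedBall (0 : E n) 1 := fun j => by
    rw [mem_closedBall_zero_iff, norm_smul, norm_inv, norm_norm]
    exact inv_mul_le_one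
  obtain ⟨v, -, σ, hσ, hσv⟩ := (isCompact_closedBall (0 : E n) 1).tendsto_subseq hball
  have hxσ : Tendsto (fun j => ‖x (σ j)‖) atTop atTop := hx.comp hσ.tendsto_atTop
  have hv1 : ‖v‖ = 1 := by
    refine tendsto_nhds_unique hσv.norm (tendsto_const_nhds.congr' ?_)
    filter_upwards [hxσ.eventually_gt_atTop 0] with j hj
    simp [norm_smul, hj.ne']
  have hv : v ≠ 0 := fun h0 => by simp [h0] at hv1
  have hchart := tendsto_affineChart hv hxσ hσv
  have hq : Tendsto (fun j => (affineChart (x (σ j)), f (x (σ j)))) atTop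
      (𝓝 ((Projectivization.mk ℝ ((0, v) : ℝ × E n) (by simp [hv]) : ProjSpace n), t₀)) :=
    hchart.prodMk_nhds (hfx.comp hσ.tendsto_atTop)
  obtain ⟨U, hU, hqU, D, hD, htD, hreg⟩ := h _
    ⟨mem_closure_of_tendsto hq (Eventually.of_forall fun j => ⟨x (σ j), (hxM _).1, rfl⟩),
      v, by simp [hv], rfl⟩ rfl
  obtain ⟨j, hj1, hj2⟩ := ((hq.eventually (hU.mem_nhds hqU)).and
    ((hfx.comp hσ.tendsto_atTop).eventually (hD.mem_nhds htD))).exists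
  obtain ⟨h1, h2, h3⟩ := hxM (σ j)
  exact h3 ((hreg _ hj2 _ h1 h2 rfl hj1).exists_eq (hρ.submersion _ h2))

end Main

end RhoReg

theorem proposition6p3 {n p d : ℕ} (hpn : p < n)
    (K : Set (RhoReg.E n)) (ρ : RhoReg.E n → ℝ) (hρ : RhoReg.IsProperSubmersionOff K ρ)
    (X : Set (RhoReg.E n)) (hX : RhoReg.IsC2Submanifold d X) (hXc : IsClosed X)
    (f : RhoReg.E n → RhoReg.E p) (hf : ContDiffOn ℝ 2 f X) :
    (∀ t₀ : RhoReg.E p, RhoReg.FibreRhoRegularAtInfinity K ρ X f t₀ →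
      RhoReg.TopTrivialAtInfinity X f t₀) ∧
    (∀ t₀ : RhoReg.E p, t₀ ∉ RhoReg.asymptoticNonregularValues K ρ X f →
      RhoReg.TopTrivialAtInfinity X f t₀) :=
  ⟨fun _ h => RhoReg.topTrivialAtInfinity_of_notMem hρ hX hXc hf (h.notMem hρ),
    fun _ h => RhoReg.topTrivialAtInfinity_of_notMem hρ hX hXc hf h⟩
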